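/- Let $F\mathbb R^{3}=\mathbb R^{3}\times Gl(3,\mathbb R)$ be the frame bundle of $\mathbb R^3$, and let $\mathcal B$ be a body, i.e. (after identification through a reference configuration) an open subset of $\mathbb R^{3}$ with frame bundle $F\mathcal B$. Local isomorphisms of frame bundles are always smooth and equivariant over the identity of $Gl(3,\mathbb R)$; the map induced by $\Psi$ on the base is denoted $\psi$. Let $\tilde J^{1}(F\mathcal B)$ be the second-order non-holonomic groupoid over $\mathcal B$, whose elements $j^1_{x,y}\Psi$ are the classes, modulo the right action of $Gl(3,\mathbb R)$, of the $1$-jets of local automorphisms $\Psi$ of $F\mathcal B$ with $\psi(x)=y$. A Cosserat medium is such a $\mathcal B$ with a smooth mechanical response $W:\tilde J^1(F\mathcal B)\to V$ ($V$ a real normed space) that does not depend on the end point: $W(j^1_{x,y}\Psi)=W(j^1_{x,z}(F\tau_{z-y}\circ\Psi))$, where $\tau_v$ is the translation by $v$. Its material groupoid is $$\overline\Omega(\mathcal B)=\{\,h\in\tilde J^1(F\mathcal B): W(g\cdot h)=W(g)\ \text{for all } g \text{ with source the target of } h\,\}.$$ $\mathcal B$ is uniform if any two of its points are joined by an element of $\overline\Omega(\mathcal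 B)$. An open $U\subseteq\mathcal B$ is homogeneous if there is an embedding of principal bundles $\tilde\kappa:FU\to F\mathbb R^3$ (over the identity of $Gl(3,\mathbb R)$, with induced map $\kappa$) such that $j^1_{x,y}(\tilde\kappa^{-1}\circ F\tau_{\kappa(y)-\kappa(x)}\circ\tilde\kappa)\in\overline\Omega(\mathcal B)$ for all $x,y\in U$. $\mathcal B$ is homogeneous if this holds for $U=\mathcal B$, and locally homogeneous if it is covered by homogeneous open subsets. For $U\subseteq \mathcal B$ open, let $\Pi^1(U,U)$ be the groupoid of $1$-jets of local diffeomorphisms of $U$, with source and target maps $\alpha$, $\beta$. A section of $(\alpha,\beta)$ is a smooth groupoid morphism $U\times U\to\Pi^1(U,U)$ from the pair groupoid, over the identity of $U$. For sections $\mathcal P,\mathcal Q$ with $\mathcal Q(x,y)=j^1_{x,y}\psi_{xy}$, the prolongation $\mathcal P^1(\mathcal Q)(x,y)\in\tilde J^1(FU)$ is the class of the $1$-jet at $x$ of $Z\mapsto \mathcal P(\pi Z,\psi_{xy}(\pi Z))\cdot Z$, where $\pi$ is the bundle projection. It is integrable if $\mathcal Q$ is integrable, i.e. around each point of $U$ there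 is a local chart $\psi$ with $\mathcal Q(x,y)=j^1_{x,y}(\psi^{-1}\circ\tau_{\psi(y)-\psi(x)}\circ\psi)$ for all $x,y$ in its domain. A subgroupoid of $\tilde J^1(F\mathcal B)$ is a second-order non-holonomic integrable prolongation if it is reduced (transitive, with base $\mathcal B$) and $\mathcal B$ is covered by open sets $U$, each with an integrable prolongation $\mathcal P^1(\mathcal Q)$ on $U\times U$ taking values in it. Then: 1. If $\mathcal B$ is homogeneous, then $\overline\Omega(\mathcal B)$ is a second-order non-holonomic integrable prolongation. 2. $\mathcal B$ is covered by open sets $U$ with integrable prolongations on $U\times U$ taking values in $\overline\Omega(\mathcal B)$ if and only if $\mathcal B$ is locally homogeneous. 3. Hence, if $\mathcal B$ is uniform or connected, $\overline\Omega(\mathcal B)$ is a second-order non-holonomic integrable prolongation if and only if $\mathcal B$ is locally homogeneous. -/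

import Mathlib

open Set Topology
open scoped ContDiff

noncomputable section

namespace Cosserat

/-- The model space `ℝⁿ`. -/
abbrev Model (n : ℕ) := EuclideanSpace ℝ (Fin n)

/-- Endomorphisms of `ℝⁿ`; multiplication is composition, and the units form `Gl(n, ℝ)`. -/
abbrev Mat (n : ℕ) := Model n →L[ℝ] Model n

/-- The vector space containing `Fℝⁿ` as an open subset.  A pair `(x, X)` with `X` invertible is
the linear frame `X : ℝⁿ → T_x ℝⁿ = ℝⁿ` at `x`. -/
abbrev FrameSpace (n : ℕ) := Model n × Mat n

/-- The frame bundle `FU` of `U ⊆ ℝⁿ`. -/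
def frameBundle {n : ℕ} (U : Set (Model n)) : Set (FrameSpace n) :=
  {z | z.1 ∈ U ∧ IsUnit z.2}

/-- The right action of `Gl(n, ℝ)` on frames (linear in the frame for fixed `g`). -/
def act {n : ℕ} (g : (Mat n)ˣ) : FrameSpace n →L[ℝ] FrameSpace n :=
  (ContinuousLinearMap.fst ℝ _ _).prod
    (((ContinuousLinearMap.compL ℝ (Model n) (Model n) (Model n)).flip (g : Mat n)).comp (ContinuousLinearMap.snd ℝ _ _))

@[simp] theorem act_apply {n : ℕ} (g : (Mat n)ˣ) (z : FrameSpace n) :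
    act g z = (z.1, z.2 * (g : Mat n)) := rfl

/-- A local isomorphism of principal bundles `FU → FV`, with `U`, `V` open in `ℝⁿ`, over the
identity of `Gl(n, ℝ)`.  (An open subset of the frame bundle which is invariant under the
action is `FU` for an open `U`.) -/
structure LocalFrameIso (n : ℕ) extends OpenPartialHomeomorph (FrameSpace n) (FrameSpace n) where
  source_subset : source ⊆ frameBundle univ
  target_subset : target ⊆ frameBundle univ
  act_mem : ∀ z ∈ source, ∀ g : (Mat n)ˣ, act g z ∈ source
  map_act : ∀ z ∈ source, ∀ g : (Mat n)ˣ, toFun (act g z) = act g (toFun z)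
  contDiffOn_toFun : ContDiffOn ℝ ∞ toFun source
  contDiffOn_invFun : ContDiffOn ℝ ∞ invFun target

namespace LocalFrameIso

variable {n : ℕ}

instance : CoeFun (LocalFrameIso n) fun _ => FrameSpace n → FrameSpace n :=
  ⟨fun Φ => Φ.toFun⟩

/-- The inverse local isomorphism. -/
def inverse (Φ : LocalFrameIso n) : LocalFrameIso n :=
  have key : ∀ w ∈ Φ.target, ∀ g : (Mat n)ˣ, Φ (act g (Φ.invFun w)) = act g w := fun w hw g => by
    rw [Φ.map_act _ (Φ.map_target' hw) g]
    exact congrArg (act g) (Φ.right_inv' hw)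
  { toOpenPartialHomeomorph := Φ.toOpenPartialHomeomorph.symm
    source_subset := Φ.target_subset
    target_subset := Φ.source_subset
    act_mem := fun w hw g => by
      have h := Φ.map_source' (Φ.act_mem _ (Φ.map_target' hw) g)
      exact (key w hw g) ▸ h
    map_act := fun w hw g => by
      have h := Φ.left_inv' (Φ.act_mem _ (Φ.map_target' hw) g)
      exact (congrArg Φ.invFun (key w hw g)).symm.trans h
    contDiffOn_toFun := Φ.contDiffOn_invFun
    contDiffOn_invFun := Φ.contDiffOn_toFun }

/-- `Φ.andThen Ψ` is the composite `Ψ ∘ Φ`, on the largest domain where it makes sense. -/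
def andThen (Φ Ψ : LocalFrameIso n) : LocalFrameIso n where
  toOpenPartialHomeomorph := Φ.toOpenPartialHomeomorph.trans Ψ.toOpenPartialHomeomorph
  source_subset := fun _ hz => Φ.source_subset hz.1
  target_subset := fun _ hz => Ψ.target_subset hz.1
  act_mem := by
    rintro z ⟨h1, h2⟩ g
    refine ⟨Φ.act_mem z h1 g, ?_⟩
    change Φ (act g z) ∈ Ψ.source
    rw [show Φ (act g z) = _ from Φ.map_act z h1 g]
    exact Ψ.act_mem _ h2 g
  map_act := by
    rintro z ⟨h1, h2⟩ g
    exact (congrArg Ψ (Φ.map_act z h1 g)).trans (Ψ.map_act _ h2 g)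
  contDiffOn_toFun :=
    Ψ.contDiffOn_toFun.comp (Φ.contDiffOn_toFun.mono fun _ h => h.1) fun _ h => h.2
  contDiffOn_invFun :=
    Φ.contDiffOn_invFun.comp (Ψ.contDiffOn_invFun.mono fun _ h => h.1) fun _ h => h.2

/-- The local isomorphism `(r, X) ↦ (ψ r, M r ∘ X)` given by a local diffeomorphism `ψ` of `ℝⁿ`
and a smooth map `M` from its domain to `Gl(n, ℝ)`. -/
def ofBase (ψ : OpenPartialHomeomorph (Model n) (Model n)) (M : Model n → Mat n)
    (hψ : ContDiffOn ℝ ∞ ψ ψ.source) (hψ' : ContDiffOn ℝ ∞ ψ.symm ψ.target)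
    (hM : ContDiffOn ℝ ∞ M ψ.source) (hU : ∀ r ∈ ψ.source, IsUnit (M r)) : LocalFrameIso n :=
  have hfst : ∀ s : Set (Model n), MapsTo Prod.fst (frameBundle s) s := fun _ _ h => h.1
  have hopen : ∀ s : Set (Model n), IsOpen s → IsOpen (frameBundle s) := fun s hs =>
    (hs.preimage continuous_fst).inter (Units.isOpen.preimage continuous_snd)
  have hto : ContDiffOn ℝ ∞ (fun z : FrameSpace n => ((ψ z.1, M z.1 * z.2) : FrameSpace n))
      (frameBundle ψ.source) :=
    (hψ.comp contDiff_fst.contDiffOn (hfst _)).prodMk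
      ((hM.comp contDiff_fst.contDiffOn (hfst _)).mul contDiff_snd.contDiffOn)
  have hinv : ContDiffOn ℝ ∞ (fun w : FrameSpace n =>
      ((ψ.symm w.1, Ring.inverse (M (ψ.symm w.1)) * w.2) : FrameSpace n))
      (frameBundle ψ.target) := by
    have h1 : ContDiffOn ℝ ∞ (fun w : FrameSpace n => ψ.symm w.1) (frameBundle ψ.target) :=
      hψ'.comp contDiff_fst.contDiffOn (hfst _)
    have h2 : ContDiffOn ℝ ∞ (fun w : FrameSpace n => M (ψ.symm w.1)) (frameBundle ψ.target) :=
      hM.comp h1 fun w hw => ψ.map_target hw.1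
    refine h1.prodMk (ContDiffOn.mul (fun w hw => ?_) contDiff_snd.contDiffOn)
    obtain ⟨u, hu⟩ := hU _ (ψ.map_target hw.1)
    have h3 := contDiffAt_ringInverse ℝ (n := ∞) u
    rw [hu] at h3
    exact h3.comp_contDiffWithinAt w (h2 w hw)
  { toFun := fun z => (ψ z.1, M z.1 * z.2)
    invFun := fun w => (ψ.symm w.1, Ring.inverse (M (ψ.symm w.1)) * w.2)
    source := frameBundle ψ.source
    target := frameBundle ψ.target
    map_source' := fun z hz => ⟨ψ.map_source hz.1, (hU _ hz.1).mul hz.2⟩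
    map_target' := fun w hw =>
      ⟨ψ.map_target hw.1, (hU _ (ψ.map_target hw.1)).ringInverse.mul hw.2⟩
    left_inv' := fun z hz => by
      simp [ψ.left_inv hz.1, ← mul_assoc, Ring.inverse_mul_cancel _ (hU _ hz.1)]
    right_inv' := fun w hw => by
      simp [ψ.right_inv hw.1, ← mul_assoc,
        Ring.mul_inverse_cancel _ (hU _ (ψ.map_target hw.1))]
    open_source := hopen _ ψ.open_source
    open_target := hopen _ ψ.open_target
    continuousOn_toFun := hto.continuousOn
    continuousOn_invFun := hinv.continuousOn
    source_subset := fun z hz => ⟨mem_univ _, hz.2⟩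
    target_subset := fun z hz => ⟨mem_univ _, hz.2⟩
    act_mem := fun z hz g => ⟨hz.1, IsUnit.mul hz.2 g.isUnit⟩
    map_act := fun z _ g => by simp [mul_assoc]
    contDiffOn_toFun := hto
    contDiffOn_invFun := hinv }

/-- `Fτ_v : Fℝⁿ → Fℝⁿ`, the isomorphism induced by the translation `τ_v r = r + v` (whose
differential is the identity). -/
def translation (v : Model n) : LocalFrameIso n :=
  ofBase (Homeomorph.addRight v).toOpenPartialHomeomorph (fun _ => 1)
    (contDiff_id.add contDiff_const).contDiffOn
    (by
      have h : ContDiff ℝ ∞ (fun r : Model n => r + -v) := contDiff_id.add contDiff_const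
      exact h.contDiffOn)
    contDiffOn_const (fun _ _ => isUnit_one)

theorem one_mem (Φ : LocalFrameIso n) {z : FrameSpace n} (hz : z ∈ Φ.source) :
    ((z.1, 1) : FrameSpace n) ∈ Φ.source := by
  obtain ⟨u, hu⟩ := (Φ.source_subset hz).2
  have h := Φ.act_mem z hz u⁻¹
  simpa [← hu] using h

theorem apply_eq (Φ : LocalFrameIso n) {z : FrameSpace n} (hz : z ∈ Φ.source) :
    Φ z = ((Φ (z.1, 1)).1, (Φ (z.1, 1)).2 * z.2) := by
  obtain ⟨u, hu⟩ := (Φ.source_subset hz).2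
  have h := Φ.map_act (z.1, 1) (Φ.one_mem hz) u
  have e : act u ((z.1, 1) : FrameSpace n) = z := by simp [hu]
  rw [e, act_apply, hu] at h
  exact h

theorem differentiableAt (Φ : LocalFrameIso n) {z : FrameSpace n} (hz : z ∈ Φ.source) :
    DifferentiableAt ℝ Φ z :=
  (Φ.contDiffOn_toFun.contDiffAt (Φ.open_source.mem_nhds hz)).differentiableAt (by simp)

theorem differentiableAt_section (Φ : LocalFrameIso n) {x : Model n}
    (hx : ((x, 1) : FrameSpace n) ∈ Φ.source) :
    DifferentiableAt ℝ (fun r => Φ (r, 1)) x :=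
  (Φ.differentiableAt hx).comp x
    (differentiableAt_id.prodMk (differentiableAt_const (1 : Mat n)))

theorem fderiv_apply (Φ : LocalFrameIso n) {z : FrameSpace n} (hz : z ∈ Φ.source)
    (v : FrameSpace n) :
    fderiv ℝ Φ z v = (fderiv ℝ (fun r => (Φ (r, 1)).1) z.1 v.1,
      fderiv ℝ (fun r => (Φ (r, 1)).2) z.1 v.1 * z.2 + (Φ (z.1, 1)).2 * v.2) := by
  have hd := Φ.differentiableAt_section (Φ.one_mem hz)
  have h1 : HasFDerivAt (fun w : FrameSpace n => (Φ (w.1, 1)).1)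
      ((fderiv ℝ (fun r => (Φ (r, 1)).1) z.1).comp (ContinuousLinearMap.fst ℝ _ _)) z :=
    HasFDerivAt.comp z (g := fun r => (Φ (r, 1)).1) hd.fst.hasFDerivAt hasFDerivAt_fst
  have h2 : HasFDerivAt (fun w : FrameSpace n => (Φ (w.1, 1)).2)
      ((fderiv ℝ (fun r => (Φ (r, 1)).2) z.1).comp (ContinuousLinearMap.fst ℝ _ _)) z :=
    HasFDerivAt.comp z (g := fun r => (Φ (r, 1)).2) hd.snd.hasFDerivAt hasFDerivAt_fst
  have h3 := h1.prodMk (h2.clm_comp (hasFDerivAt_snd (𝕜 := ℝ) (p := z)))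
  have h4 : (Φ : FrameSpace n → FrameSpace n) =ᶠ[𝓝 z]
      fun w => ((Φ (w.1, 1)).1, (Φ (w.1, 1)).2.comp w.2) := by
    filter_upwards [Φ.open_source.mem_nhds hz] with w hw using Φ.apply_eq hw
  rw [h4.fderiv_eq, h3.fderiv]
  ext1
  · simp
  · simp [ContinuousLinearMap.mul_def, add_comm]

end LocalFrameIso

section Jets

variable {n : ℕ}

/-- The vector space in which the second-order non-holonomic groupoid of an open subset of `ℝⁿ`
lies as an open subset, by the canonical coordinates `(xⁱ, yʲ, yʲᵢ, yʲ,ᵢ, yʲᵢ,ₖ)`. -/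
abbrev NHJet (n : ℕ) := Model n × Model n × Mat n × Mat n × (Model n →L[ℝ] Mat n)

/-- Source `x`. -/
def NHJet.src (j : NHJet n) : Model n := j.1

/-- Target `y`. -/
def NHJet.tgt (j : NHJet n) : Model n := j.2.1

/-- The component `yʲᵢ`. -/
def NHJet.fib (j : NHJet n) : Mat n := j.2.2.1

/-- The component `yʲ,ᵢ`. -/
def NHJet.lin (j : NHJet n) : Mat n := j.2.2.2.1

/-- The component `yʲᵢ,ₖ`, as the linear map taking the `k`-th basis vector to the matrix
`(yʲᵢ,ₖ)`. -/
def NHJet.mix (j : NHJet n) : Model n →L[ℝ] Mat n := j.2.2.2.2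

/-- The class `j¹_{x,y} Ψ`, modulo `Gl(n, ℝ)`, of the 1-jets of `Ψ` at the frames over `x`, through
the value and the first partial derivatives in the base direction at the frame `e₁ₓ = (x, 1)`.
By `jet_eq_jet_iff` below, these are a complete invariant of the class. -/
def jet (Ψ : FrameSpace n → FrameSpace n) (x : Model n) : NHJet n :=
  (x, (Ψ (x, 1)).1, (Ψ (x, 1)).2,
    fderiv ℝ (fun r => (Ψ (r, 1)).1) x, fderiv ℝ (fun r => (Ψ (r, 1)).2) x)

/-- The second-order non-holonomic groupoid `J̃¹(FB)` over `B`: the classes of the 1-jets of the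
local automorphisms of `FB`. -/
def nhGroupoid (B : Set (Model n)) : Set (NHJet n) :=
  {j | ∃ (Ψ : LocalFrameIso n) (x : Model n), Ψ.source ⊆ frameBundle B ∧
    Ψ.target ⊆ frameBundle B ∧ ((x, 1) : FrameSpace n) ∈ Ψ.source ∧ j = jet Ψ x}

/-- The composition `k · j` in the groupoid (meaningful for `src k = tgt j`): the jet of the
composite map, see `jet_andThen`. -/
def NHJet.comp (k j : NHJet n) : NHJet n :=
  (j.src, k.tgt, k.fib * j.fib, k.lin * j.lin,
    (ContinuousLinearMap.compL ℝ (Model n) (Model n) (Model n) k.fib).comp j.mix +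
      ((ContinuousLinearMap.compL ℝ (Model n) (Model n) (Model n)).flip j.fib).comp
        (k.mix.comp j.lin))

/-- The identity `ε(x)` of the groupoid at `x`. -/
def NHJet.one (x : Model n) : NHJet n := (x, x, 1, 1, 0)

/-- Two local isomorphisms have the same `jet` exactly if the 1-jets `j¹_{z, Φ z} Φ` and
`j¹_{z', Φ' z'} Φ'` at frames `z`, `z'` lie in the same orbit of the action of `Gl(n, ℝ)`. -/
theorem jet_eq_jet_iff (Φ Φ' : LocalFrameIso n) {z z' : FrameSpace n}
    (hz : z ∈ Φ.source) (hz' : z' ∈ Φ'.source) :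
    jet Φ z.1 = jet Φ' z'.1 ↔
      ∃ g : (Mat n)ˣ, z' = act g z ∧ Φ' z' = act g (Φ z) ∧
        (fderiv ℝ Φ' z').comp (act g) = (act g).comp (fderiv ℝ Φ z) := by
  obtain ⟨x, X⟩ := z
  obtain ⟨x', X'⟩ := z'
  have a1 := Φ.apply_eq hz
  have a2 := Φ'.apply_eq hz'
  have d1 := Φ.fderiv_apply hz
  have d2 := Φ'.fderiv_apply hz'
  obtain ⟨u, rfl⟩ : IsUnit X := (Φ.source_subset hz).2
  obtain ⟨u', rfl⟩ : IsUnit X' := (Φ'.source_subset hz').2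
  simp only at a1 a2 d1 d2
  constructor
  · intro h
    simp only [jet, Prod.mk.injEq] at h
    obtain ⟨rfl, h1, h2, h3, h4⟩ := h
    refine ⟨u⁻¹ * u', by simp, ?_, ?_⟩
    · rw [a1, a2, act_apply, h1, h2]
      simp [mul_assoc]
    · refine ContinuousLinearMap.ext fun v => ?_
      simp only [ContinuousLinearMap.comp_apply, d1, d2, act_apply, h2, h3, h4]
      simp [mul_assoc, add_mul]
  · rintro ⟨g, h1, h2, h3⟩
    rw [act_apply, Prod.mk.injEq] at h1
    obtain ⟨rfl, h1⟩ := h1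
    rw [a1, a2, act_apply, h1, Prod.mk.injEq, ← mul_assoc] at h2
    obtain ⟨h4, h5⟩ := h2
    have h5' := u.isUnit.mul_right_cancel (g.isUnit.mul_right_cancel h5)
    rw [h1] at d2
    have h6 : ∀ v : Model n, _ := fun v => DFunLike.congr_fun h3 (v, 0)
    simp only [ContinuousLinearMap.comp_apply, d1, d2, act_apply, h1, Prod.mk.injEq, zero_mul,
      mul_zero, add_zero, ← mul_assoc] at h6
    simp only [jet, Prod.mk.injEq]
    exact ⟨trivial, h4.symm, h5'.symm, ContinuousLinearMap.ext fun v => (h6 v).1.symm,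
      ContinuousLinearMap.ext fun v =>
        (u.isUnit.mul_right_cancel (g.isUnit.mul_right_cancel (h6 v).2)).symm⟩

/-- Composition in the groupoid is composition of jets. -/
theorem jet_andThen (Φ Ψ : LocalFrameIso n) {x : Model n}
    (hx : ((x, 1) : FrameSpace n) ∈ (Φ.andThen Ψ).source) :
    jet (Φ.andThen Ψ) x = (jet Ψ (Φ (x, 1)).1).comp (jet Φ x) := by
  have hx1 : ((x, 1) : FrameSpace n) ∈ Φ.source := hx.1
  have hx2 : Φ (x, 1) ∈ Ψ.source := hx.2
  have hd := Φ.differentiableAt_section hx1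
  have hd' := Ψ.differentiableAt_section (Ψ.one_mem hx2)
  have hev : ∀ᶠ r in 𝓝 x, (Φ.andThen Ψ) (r, 1) =
      ((Ψ ((Φ (r, 1)).1, 1)).1, (Ψ ((Φ (r, 1)).1, 1)).2.comp (Φ (r, 1)).2) := by
    have hc : ContinuousAt (fun r : Model n => ((r, 1) : FrameSpace n)) x := by fun_prop
    filter_upwards [hc ((Φ.andThen Ψ).open_source.mem_nhds hx)] with r hr
    exact Ψ.apply_eq hr.2
  have h1 : HasFDerivAt (fun r => (Ψ ((Φ (r, 1)).1, 1)).1)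
      ((fderiv ℝ (fun r => (Ψ (r, 1)).1) (Φ (x, 1)).1).comp
        (fderiv ℝ (fun r => (Φ (r, 1)).1) x)) x :=
    HasFDerivAt.comp x (g := fun r => (Ψ (r, 1)).1) hd'.fst.hasFDerivAt hd.fst.hasFDerivAt
  have h2 : HasFDerivAt (fun r => (Ψ ((Φ (r, 1)).1, 1)).2)
      ((fderiv ℝ (fun r => (Ψ (r, 1)).2) (Φ (x, 1)).1).comp
        (fderiv ℝ (fun r => (Φ (r, 1)).1) x)) x :=
    HasFDerivAt.comp x (g := fun r => (Ψ (r, 1)).2) hd'.snd.hasFDerivAt hd.fst.hasFDerivAt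
  have h3 := h2.clm_comp hd.snd.hasFDerivAt
  have e := hev.self_of_nhds
  have e3 : fderiv ℝ (fun r => ((Φ.andThen Ψ) (r, 1)).1) x = _ :=
    (Filter.EventuallyEq.fderiv_eq (hev.mono fun r hr => congrArg Prod.fst hr)).trans h1.fderiv
  have e4 : fderiv ℝ (fun r => ((Φ.andThen Ψ) (r, 1)).2) x = _ :=
    (Filter.EventuallyEq.fderiv_eq (hev.mono fun r hr => congrArg Prod.snd hr)).trans h3.fderiv
  unfold jet NHJet.comp
  rw [e3, e4, e]
  rfl

theorem jet_mem_aux (Φ Ψ : LocalFrameIso n) {x : Model n}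
    (hx : ((x, 1) : FrameSpace n) ∈ (Φ.andThen Ψ).source)
    (hid : ∀ z ∈ (Φ.andThen Ψ).source, Ψ (Φ z) = z) :
    (jet Ψ (Φ (x, 1)).1).lin * (jet Φ x).lin = 1 := by
  have hc : ContinuousAt (fun r : Model n => ((r, 1) : FrameSpace n)) x := by fun_prop
  have h1 : (fun r => ((Φ.andThen Ψ) (r, 1)).1) =ᶠ[𝓝 x] id := by
    filter_upwards [hc ((Φ.andThen Ψ).open_source.mem_nhds hx)] with r hr
    exact congrArg Prod.fst (hid _ hr)
  have h2 := congrArg NHJet.lin (jet_andThen Φ Ψ hx)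
  have h3 : (jet (Φ.andThen Ψ) x).lin = 1 := h1.fderiv_eq.trans fderiv_id
  rw [h3] at h2
  exact h2.symm

/-- The groupoid over an open set `B` in coordinates. -/
theorem mem_nhGroupoid_iff {B : Set (Model n)} (hB : IsOpen B) (j : NHJet n) :
    j ∈ nhGroupoid B ↔ j.src ∈ B ∧ j.tgt ∈ B ∧ IsUnit j.fib ∧ IsUnit j.lin := by
  constructor
  · rintro ⟨Φ, x, h1, h2, hx, rfl⟩
    have hy : Φ (x, 1) ∈ Φ.target := Φ.map_source' hx
    refine ⟨(h1 hx).1, (h2 hy).1, (h2 hy).2, ?_⟩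
    have hy1 := Φ.inverse.one_mem (z := Φ (x, 1)) hy
    have e1 := jet_mem_aux Φ Φ.inverse (x := x) ⟨hx, hy⟩ fun z hz => Φ.left_inv' hz.1
    obtain ⟨u, hu⟩ := (h2 hy).2
    -- the differential of the inverse at the target
    have hxs : Φ.inverse (Φ (x, 1)) = (x, 1) := Φ.left_inv' hx
    have hb : (Φ.inverse ((Φ (x, 1)).1, 1)).1 = x := by
      have h := Φ.inverse.apply_eq (z := Φ (x, 1)) hy
      rw [hxs] at h
      exact (congrArg Prod.fst h).symm
    have e2 := jet_mem_aux Φ.inverse Φ (x := (Φ (x, 1)).1) ⟨hy1, Φ.map_target' hy1⟩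
      fun z hz => Φ.right_inv' hz.1
    rw [hb] at e2
    exact ⟨⟨_, _, e2, e1⟩, rfl⟩
  · obtain ⟨x, y, P, Q, R⟩ := j
    rintro ⟨hx, hy, hP, ⟨q, hq⟩⟩
    simp only [NHJet.src, NHJet.tgt, NHJet.fib, NHJet.lin] at hx hy hP hq
    subst hq
    let A : Model n ≃ₜ Model n :=
      { toFun := fun r => y + (q : Mat n) (r - x)
        invFun := fun s => x + ((q⁻¹ : (Mat n)ˣ) : Mat n) (s - y)
        left_inv := fun r => by
          have h : ((q⁻¹ : (Mat n)ˣ) : Mat n) ((q : Mat n) (r - x)) = r - x :=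
            DFunLike.congr_fun (Units.inv_mul q) (r - x)
          simp only [add_sub_cancel_left, h, add_sub_cancel]
        right_inv := fun r => by
          have h : (q : Mat n) (((q⁻¹ : (Mat n)ˣ) : Mat n) (r - y)) = r - y :=
            DFunLike.congr_fun (Units.mul_inv q) (r - y)
          simp only [add_sub_cancel_left, h, add_sub_cancel]
        continuous_toFun := by fun_prop
        continuous_invFun := by fun_prop }
    have hM : ContDiff ℝ ∞ (fun r : Model n => P + R (r - x)) := by fun_prop
    let U : Set (Model n) := {r | r ∈ B ∧ A r ∈ B ∧ IsUnit (P + R (r - x))}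
    have hU : IsOpen U :=
      hB.inter ((hB.preimage A.continuous).inter (Units.isOpen.preimage hM.continuous))
    have hA : ContDiff ℝ ∞ A := by
      have h : ContDiff ℝ ∞ (fun r : Model n => y + (q : Mat n) (r - x)) := by fun_prop
      exact h
    have hA' : ContDiff ℝ ∞ A.symm := by
      have h : ContDiff ℝ ∞ (fun s : Model n => x + ((q⁻¹ : (Mat n)ˣ) : Mat n) (s - y)) := by
        fun_prop
      exact h
    let ψ := A.toOpenPartialHomeomorphOfImageEq U hU (A '' U) rfl
    let Φ := LocalFrameIso.ofBase ψ (fun r => P + R (r - x)) hA.contDiffOn hA'.contDiffOn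
      hM.contDiffOn fun r hr => hr.2.2
    have hAx : A x = y := by simp [A]
    have hxU : x ∈ U := ⟨hx, hAx ▸ hy, by simpa using hP⟩
    refine ⟨Φ, x, fun z hz => ⟨hz.1.1, hz.2⟩, ?_, ⟨hxU, isUnit_one⟩, ?_⟩
    · rintro w ⟨⟨r, hr, hrw⟩, hw⟩
      exact ⟨hrw ▸ hr.2.1, hw⟩
    · have e1 : ∀ r, Φ (r, 1) = (y + (q : Mat n) (r - x), P + R (r - x)) := fun r =>
        Prod.ext rfl (mul_one _)
      have d1 : HasFDerivAt (fun r : Model n => y + (q : Mat n) (r - x)) (q : Mat n) x :=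
        ((q : Mat n).hasFDerivAt.comp x ((hasFDerivAt_id x).sub_const x)).const_add y
      have d2 : HasFDerivAt (fun r : Model n => P + R (r - x)) R x :=
        (R.hasFDerivAt.comp x ((hasFDerivAt_id x).sub_const x)).const_add P
      simp only [jet, e1, d1.fderiv, d2.fderiv, sub_self, map_zero, add_zero]

end Jets

section Prolongations

variable {n : ℕ}

/-- A section of `(α, β)` in the groupoid `Π¹(U, U)` of 1-jets of local diffeomorphisms of the open
set `U ⊆ ℝⁿ`: a smooth groupoid morphism `P` from the pair groupoid `U × U` to `Π¹(U, U)` over the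
identity of `U`.  Here `P x y : T_x U → T_y U` is the invertible linear part of the 1-jet assigned
to `(x, y)`. -/
structure IsSection (U : Set (Model n)) (P : Model n → Model n → Mat n) : Prop where
  contDiffOn : ContDiffOn ℝ ∞ (fun p : Model n × Model n => P p.1 p.2) (U ×ˢ U)
  isUnit : ∀ x ∈ U, ∀ y ∈ U, IsUnit (P x y)
  map_comp : ∀ x ∈ U, ∀ y ∈ U, ∀ z ∈ U, P y z * P x y = P x z

/-- A section `Q` of `Π¹(U, U)` is integrable if around each point there is a local chart `ψ` with
`Q x y = j¹_{x,y} (ψ⁻¹ ∘ τ_{ψ(y) - ψ(x)} ∘ ψ)`. -/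
def IsIntegrableSection (U : Set (Model n)) (Q : Model n → Model n → Mat n) : Prop :=
  IsSection U Q ∧ ∀ z ∈ U, ∃ ψ : OpenPartialHomeomorph (Model n) (Model n),
    z ∈ ψ.source ∧ ψ.source ⊆ U ∧ ContDiffOn ℝ ∞ ψ ψ.source ∧
    ContDiffOn ℝ ∞ ψ.symm ψ.target ∧
    ∀ x ∈ ψ.source, ∀ y ∈ ψ.source,
      Q x y = fderiv ℝ (fun r => ψ.symm (ψ r + (ψ y - ψ x))) x

/-- The map `Z ↦ P(π Z, ψ(π Z)) · Z` of frames, over the map `ψ` of the base. -/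
def prolongationMap (P : Model n → Model n → Mat n) (ψ : Model n → Model n) :
    FrameSpace n → FrameSpace n :=
  fun z => (ψ z.1, P z.1 (ψ z.1) * z.2)

/-- The second-order non-holonomic prolongation `P¹(Q)`: its value at `(x, y)` is the jet at `x` of
`prolongationMap P ψ`, where `ψ` has the 1-jet `Q x y` from `x` to `y`.  The choice of `ψ` does not
matter (`prolongation_eq_jet`); the affine one is taken. -/
def prolongation (P Q : Model n → Model n → Mat n) (x y : Model n) : NHJet n :=
  jet (prolongationMap P fun r => y + Q x y (r - x)) x

theorem prolongation_eq_jet {P Q : Model n → Model n → Mat n} {x y : Model n}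
    (hP : DifferentiableAt ℝ (fun p : Model n × Model n => P p.1 p.2) (x, y))
    {ψ : Model n → Model n} (hψ : HasFDerivAt ψ (Q x y) x) (hy : ψ x = y) :
    prolongation P Q x y = jet (prolongationMap P ψ) x := by
  subst hy
  have hA : HasFDerivAt (fun r : Model n => ψ x + Q x (ψ x) (r - x)) (Q x (ψ x)) x :=
    ((Q x (ψ x)).hasFDerivAt.comp x ((hasFDerivAt_id x).sub_const x)).const_add _
  have key : ∀ χ : Model n → Model n, HasFDerivAt χ (Q x (ψ x)) x → χ x = ψ x →
      HasFDerivAt (fun r => P r (χ r))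
        ((fderiv ℝ (fun p : Model n × Model n => P p.1 p.2) (x, ψ x)).comp
          ((ContinuousLinearMap.id ℝ _).prod (Q x (ψ x)))) x := by
    intro χ hχ he
    rw [← he] at hP ⊢
    rw [← he] at hχ
    exact HasFDerivAt.comp x (g := fun p : Model n × Model n => P p.1 p.2) hP.hasFDerivAt
      ((hasFDerivAt_id x).prodMk hχ)
  simp only [prolongation, jet, prolongationMap, mul_one, hA.fderiv, hψ.fderiv,
    (key _ hψ rfl).fderiv, (key _ hA (by simp)).fderiv, sub_self, map_zero, add_zero]

/-- `Ω` is a reduced subgroupoid of the second-order non-holonomic groupoid over `B`, i.e. a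
transitive subgroupoid with base `B`. -/
structure IsReducedSubgroupoid (B : Set (Model n)) (Ω : Set (NHJet n)) : Prop where
  subset : Ω ⊆ nhGroupoid B
  one_mem : ∀ x ∈ B, NHJet.one x ∈ Ω
  comp_mem : ∀ k ∈ Ω, ∀ j ∈ Ω, k.src = j.tgt → k.comp j ∈ Ω
  inv_mem : ∀ j ∈ Ω, ∃ k ∈ Ω, k.src = j.tgt ∧ k.tgt = j.src ∧
    k.comp j = NHJet.one j.src ∧ j.comp k = NHJet.one j.tgt
  transitive : ∀ x ∈ B, ∀ y ∈ B, ∃ j ∈ Ω, j.src = x ∧ j.tgt = y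

/-- `B` is covered by open sets `U` with integrable prolongations `P¹(Q)` over `U` (prolongations
with `Q` integrable) which take values in `Ω`. -/
def IsCoveredByIntegrableProlongations (B : Set (Model n)) (Ω : Set (NHJet n)) : Prop :=
  ∀ z ∈ B, ∃ U : Set (Model n), IsOpen U ∧ z ∈ U ∧ U ⊆ B ∧
    ∃ P Q : Model n → Model n → Mat n, IsSection U P ∧ IsIntegrableSection U Q ∧
      ∀ x ∈ U, ∀ y ∈ U, prolongation P Q x y ∈ Ω

/-- `Ω` is a second-order non-holonomic integrable prolongation: it is a reduced subgroupoid and `B`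
can be covered by local integrable prolongations with values in it. -/
def IsIntegrableProlongation (B : Set (Model n)) (Ω : Set (NHJet n)) : Prop :=
  IsReducedSubgroupoid B Ω ∧ IsCoveredByIntegrableProlongations B Ω

end Prolongations

/-- A Cosserat medium: the frame bundle of a body `B`, identified through a reference
configuration with an open subset of `ℝ³`, together with a mechanical response
`W : J̃¹(FB) → V` (only the values of `W` on `nhGroupoid body` matter) which is smooth and does not
depend on the end point: `W (j_{x,y} Ψ) = W (j_{x,z} (Fτ_{z-y} ∘ Ψ))`. -/
structure Medium (V : Type*) [NormedAddCommGroup V] [NormedSpace ℝ V] where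
  body : Set (Model 3)
  isOpen_body : IsOpen body
  W : NHJet 3 → V
  contDiffOn_W : ContDiffOn ℝ ∞ W (nhGroupoid body)
  W_endpoint : ∀ j ∈ nhGroupoid body, ∀ z ∈ body,
    W ((jet (LocalFrameIso.translation (z - j.tgt)) j.tgt).comp j) = W j

namespace Medium

variable {V : Type*} [NormedAddCommGroup V] [NormedSpace ℝ V] (𝓑 : Medium V)

/-- The second-order non-holonomic material groupoid `Ω̄(B)`: the jets `j` with `W (g · j) = W g` for
all infinitesimal deformations `g` at the target of `j`.  As `W` does not depend on the end point,
it is enough to consider those `g` whose end point is in the body. -/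
def materialGroupoid : Set (NHJet 3) :=
  {j | j ∈ nhGroupoid 𝓑.body ∧
    ∀ g ∈ nhGroupoid 𝓑.body, g.src = j.tgt → 𝓑.W (g.comp j) = 𝓑.W g}

/-- Any two points are related by a material isomorphism. -/
def IsUniform : Prop :=
  ∀ x ∈ 𝓑.body, ∀ y ∈ 𝓑.body, ∃ Ψ : LocalFrameIso 3,
    Ψ.source ⊆ frameBundle 𝓑.body ∧ Ψ.target ⊆ frameBundle 𝓑.body ∧
    ((x, 1) : FrameSpace 3) ∈ Ψ.source ∧ (Ψ (x, 1)).1 = y ∧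
    ∀ g ∈ nhGroupoid 𝓑.body, g.src = y → 𝓑.W (g.comp (jet Ψ x)) = 𝓑.W g

/-- The open subset `U` of the body is homogeneous: there is a deformation `K : FU → Fℝ³`, with
induced map `κ` on `U`, such that `j_{x,y} (K⁻¹ ∘ Fτ_{κ(y) - κ(x)} ∘ K)` lies in the material
groupoid for all `x, y ∈ U`.  (An embedding of principal bundles `FU → Fℝ³` is the same as an
isomorphism of `FU` onto `FV` for an open `V ⊆ ℝ³`.) -/
def IsHomogeneousOn (U : Set (Model 3)) : Prop :=
  ∃ K : LocalFrameIso 3, K.source = frameBundle U ∧ ∀ x ∈ U, ∀ y ∈ U,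
    jet ((K.andThen (LocalFrameIso.translation ((K (y, 1)).1 - (K (x, 1)).1))).andThen K.inverse) x
      ∈ 𝓑.materialGroupoid

/-- The medium is homogeneous: it admits a global deformation as above. -/
def IsHomogeneous : Prop := 𝓑.IsHomogeneousOn 𝓑.body

/-- The medium is locally homogeneous: it is covered by homogeneous open subsets. -/
def IsLocallyHomogeneous : Prop :=
  ∀ z ∈ 𝓑.body, ∃ U : Set (Model 3), IsOpen U ∧ z ∈ U ∧ U ⊆ 𝓑.body ∧ 𝓑.IsHomogeneousOn U

end Medium

end Cosserat

end

/-!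
A local isomorphism `K` of frame bundles is a pair: the local diffeomorphism `κ` of the base and
the field `k` of matrices with `K (r, X) = (κ r, k r * X)`.  The jet at `x` of
`K⁻¹ ∘ Fτ_{κ y - κ x} ∘ K` is then exactly the value at `(x, y)` of the prolongation `P¹(Q)` with
`P x y = (k y)⁻¹ * k x` and `Q x y = (Dκ y)⁻¹ * Dκ x` (`jet_conj_translation`), and `Q` is
integrable with chart `κ`.  Hence a homogeneous open set carries an integrable prolongation with
values in the material groupoid.

Conversely let `P¹(Q)` be an integrable prolongation over `U`, let `ψ` be a chart for `Q` and `z` a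
point of its domain.  Since `P y z * P x y = P x z`, the isomorphism `K (r, X) = (ψ r, P r z * X)`
gives back `P` and `Q` by the formulas above, so the domain of `ψ` is homogeneous
(`isHomogeneousOn_of_prolongation`).

The material groupoid is always a subgroupoid; only its transitivity is at stake.  On a homogeneous
or a uniform body it is immediate.  On a connected body it follows from the cover: over each of its
open sets the prolongation joins any two points, so being joined by a material isomorphism is an
equivalence relation with open classes.
-/

open Set Topology
open scoped ContDiff

namespace Cosserat

/-! ### Base map and matrix field of a local isomorphism -/

namespace LocalFrameIso

variable {n : ℕ}

theorem inverse_apply (Φ : LocalFrameIso n) {z : FrameSpace n} (hz : z ∈ Φ.source) :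
    Φ.inverse (Φ z) = z :=
  Φ.left_inv' hz

theorem inverse_fst_apply (Φ : LocalFrameIso n) {z : FrameSpace n} (hz : z ∈ Φ.source) :
    (Φ.inverse ((Φ z).1, 1)).1 = z.1 := by
  have h := Φ.inverse.apply_eq (z := Φ z) (Φ.map_source' hz)
  rw [Φ.inverse_apply hz] at h
  exact (congrArg Prod.fst h).symm

theorem inverse_snd_mul (Φ : LocalFrameIso n) {z : FrameSpace n} (hz : z ∈ Φ.source) :
    (Φ.inverse ((Φ z).1, 1)).2 * (Φ z).2 = z.2 := by
  have h := Φ.inverse.apply_eq (z := Φ z) (Φ.map_source' hz)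
  rw [Φ.inverse_apply hz] at h
  exact (congrArg Prod.snd h).symm

theorem continuous_prodMk_one : Continuous fun r : Model n => ((r, 1) : FrameSpace n) := by
  fun_prop

theorem contDiff_prodMk_one : ContDiff ℝ ∞ fun r : Model n => ((r, 1) : FrameSpace n) :=
  contDiff_id.prodMk contDiff_const

/-- The local diffeomorphism of `ℝⁿ` induced by a local isomorphism of frame bundles. -/
noncomputable def base (Φ : LocalFrameIso n) : OpenPartialHomeomorph (Model n) (Model n) where
  toFun r := (Φ (r, 1)).1
  invFun s := (Φ.inverse (s, 1)).1
  source := {r | ((r, 1) : FrameSpace n) ∈ Φ.source}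
  target := {s | ((s, 1) : FrameSpace n) ∈ Φ.target}
  map_source' _ hr := Φ.inverse.one_mem (Φ.map_source' hr)
  map_target' _ hs := Φ.one_mem (Φ.inverse.map_source' hs)
  left_inv' _ hr := Φ.inverse_fst_apply hr
  right_inv' _ hs := Φ.inverse.inverse_fst_apply hs
  open_source := Φ.open_source.preimage continuous_prodMk_one
  open_target := Φ.open_target.preimage continuous_prodMk_one
  continuousOn_toFun := continuous_fst.comp_continuousOn
    (Φ.contDiffOn_toFun.continuousOn.comp continuous_prodMk_one.continuousOn fun _ h => h)
  continuousOn_invFun := continuous_fst.comp_continuousOn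
    (Φ.contDiffOn_invFun.continuousOn.comp continuous_prodMk_one.continuousOn fun _ h => h)

/-- The matrix field `k` with `Φ (r, X) = (Φ.base r, k r * X)`. -/
noncomputable def fiber (Φ : LocalFrameIso n) (r : Model n) : Mat n := (Φ (r, 1)).2

theorem apply_eq_base_fiber (Φ : LocalFrameIso n) {z : FrameSpace n} (hz : z ∈ Φ.source) :
    Φ z = (Φ.base z.1, Φ.fiber z.1 * z.2) :=
  Φ.apply_eq hz

theorem mem_source_iff (Φ : LocalFrameIso n) {z : FrameSpace n} :
    z ∈ Φ.source ↔ z.1 ∈ Φ.base.source ∧ IsUnit z.2 := by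
  refine ⟨fun h => ⟨Φ.one_mem h, (Φ.source_subset h).2⟩, ?_⟩
  obtain ⟨r, X⟩ := z
  rintro ⟨h, u, rfl⟩
  simpa using Φ.act_mem _ h u

theorem isUnit_fiber (Φ : LocalFrameIso n) {r : Model n} (hr : r ∈ Φ.base.source) :
    IsUnit (Φ.fiber r) :=
  (Φ.target_subset (Φ.map_source' hr)).2

theorem contDiffOn_base (Φ : LocalFrameIso n) : ContDiffOn ℝ ∞ Φ.base Φ.base.source :=
  contDiff_fst.comp_contDiffOn
    (Φ.contDiffOn_toFun.comp contDiff_prodMk_one.contDiffOn fun _ h => h)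

theorem contDiffOn_fiber (Φ : LocalFrameIso n) : ContDiffOn ℝ ∞ Φ.fiber Φ.base.source :=
  contDiff_snd.comp_contDiffOn
    (Φ.contDiffOn_toFun.comp contDiff_prodMk_one.contDiffOn fun _ h => h)

theorem contDiffOn_base_symm (Φ : LocalFrameIso n) :
    ContDiffOn ℝ ∞ Φ.base.symm Φ.base.target :=
  Φ.inverse.contDiffOn_base

theorem inverse_fiber_mul_fiber (Φ : LocalFrameIso n) {r : Model n} (hr : r ∈ Φ.base.source) :
    Φ.inverse.fiber (Φ.base r) * Φ.fiber r = 1 :=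
  Φ.inverse_snd_mul (z := (r, 1)) hr

theorem fiber_mul_inverse_fiber (Φ : LocalFrameIso n) {r : Model n} (hr : r ∈ Φ.base.source) :
    Φ.fiber r * Φ.inverse.fiber (Φ.base r) = 1 := by
  have h := Φ.inverse.inverse_fiber_mul_fiber (Φ.base.map_source hr)
  rwa [show Φ.inverse.base (Φ.base r) = r from Φ.base.left_inv hr] at h

end LocalFrameIso

variable {n : ℕ}

/-! ### Jets depend only on germs -/

theorem jet_congr {Φ Ψ : FrameSpace n → FrameSpace n} {x : Model n}
    (h : ∀ᶠ r in 𝓝 x, Φ (r, 1) = Ψ (r, 1)) : jet Φ x = jet Ψ x := by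
  have h1 : fderiv ℝ (fun r => (Φ (r, 1)).1) x = fderiv ℝ (fun r => (Ψ (r, 1)).1) x :=
    Filter.EventuallyEq.fderiv_eq (h.mono fun r hr => congrArg Prod.fst hr)
  have h2 : fderiv ℝ (fun r => (Φ (r, 1)).2) x = fderiv ℝ (fun r => (Ψ (r, 1)).2) x :=
    Filter.EventuallyEq.fderiv_eq (h.mono fun r hr => congrArg Prod.snd hr)
  simp only [jet, h1, h2, h.self_of_nhds]

theorem jet_eq_one {Φ : FrameSpace n → FrameSpace n} {x : Model n}
    (h : ∀ᶠ r in 𝓝 x, Φ (r, 1) = (r, 1)) : jet Φ x = NHJet.one x := by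
  rw [jet_congr (Ψ := id) h]
  simp only [jet, id, NHJet.one, fderiv_fun_const, Pi.zero_apply]
  rw [show fderiv ℝ (fun r : Model n => r) x = 1 from fderiv_id]

theorem prolongation_src (P Q : Model n → Model n → Mat n) (x y : Model n) :
    (prolongation P Q x y).src = x := rfl

theorem prolongation_tgt (P Q : Model n → Model n → Mat n) (x y : Model n) :
    (prolongation P Q x y).tgt = y := by
  simp [prolongation, jet, NHJet.tgt, prolongationMap]

theorem prolongation_congr {P P' Q Q' : Model n → Model n → Mat n} {x y : Model n}
    (hP : ∀ᶠ p in 𝓝 (x, y), P p.1 p.2 = P' p.1 p.2) (hQ : Q x y = Q' x y) :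
    prolongation P Q x y = prolongation P' Q' x y := by
  unfold prolongation
  rw [hQ]
  refine jet_congr ?_
  have hc : Filter.Tendsto (fun r => (r, y + Q' x y (r - x))) (𝓝 x) (𝓝 (x, y)) := by
    have h : Continuous fun r => (r, y + Q' x y (r - x)) := by fun_prop
    simpa using h.tendsto x
  filter_upwards [hc.eventually hP] with r hr
  simp only [prolongationMap, hr]

/-! ### The groupoid structure -/

theorem NHJet.comp_assoc (l k j : NHJet n) : (l.comp k).comp j = l.comp (k.comp j) := by
  simp only [NHJet.comp, NHJet.src, NHJet.tgt, NHJet.fib, NHJet.lin, NHJet.mix, mul_assoc,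
    Prod.mk.injEq, true_and]
  ext v w : 2
  simp [ContinuousLinearMap.mul_def, add_assoc]

theorem NHJet.comp_one (j : NHJet n) : j.comp (NHJet.one j.src) = j := by
  simp only [NHJet.comp, NHJet.one, NHJet.src, NHJet.tgt, NHJet.fib, NHJet.lin, NHJet.mix, mul_one]
  refine Prod.ext rfl (Prod.ext rfl (Prod.ext rfl (Prod.ext rfl ?_)))
  ext v w : 2
  simp [ContinuousLinearMap.one_def]

theorem one_mem_nhGroupoid {B : Set (Model n)} (hB : IsOpen B) {x : Model n} (hx : x ∈ B) :
    NHJet.one x ∈ nhGroupoid B :=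
  (mem_nhGroupoid_iff hB _).2 ⟨hx, hx, isUnit_one, isUnit_one⟩

theorem comp_mem_nhGroupoid {B : Set (Model n)} (hB : IsOpen B) {k j : NHJet n}
    (hk : k ∈ nhGroupoid B) (hj : j ∈ nhGroupoid B) : k.comp j ∈ nhGroupoid B := by
  rw [mem_nhGroupoid_iff hB] at hk hj ⊢
  exact ⟨hj.1, hk.2.1, hk.2.2.1.mul hj.2.2.1, hk.2.2.2.mul hj.2.2.2⟩

/-- The inverse of the jet of `Φ` is the jet of the inverse of `Φ`. -/
theorem exists_inverse_mem_nhGroupoid {B : Set (Model n)} {j : NHJet n} (hj : j ∈ nhGroupoid B) :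
    ∃ k ∈ nhGroupoid B, k.src = j.tgt ∧ k.tgt = j.src ∧
      k.comp j = NHJet.one j.src ∧ j.comp k = NHJet.one j.tgt := by
  obtain ⟨Φ, x, h1, h2, hx, rfl⟩ := hj
  have hxb : x ∈ Φ.base.source := hx
  have hyb := Φ.base.map_source hxb
  have hl : (Φ.inverse (Φ.base x, 1)).1 = x := Φ.base.left_inv hxb
  have key : ∀ (Ψ : LocalFrameIso n) {r : Model n}, r ∈ Ψ.base.source →
      (jet Ψ.inverse (Ψ.base r)).comp (jet Ψ r) = NHJet.one r := fun Ψ r hr => by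
    rw [show Ψ.base r = (Ψ (r, 1)).1 from rfl,
      ← jet_andThen Ψ Ψ.inverse ⟨hr, Ψ.map_source' hr⟩]
    refine jet_eq_one ?_
    filter_upwards [Ψ.base.open_source.mem_nhds hr] with s hs
    exact Ψ.inverse_apply hs
  refine ⟨jet Φ.inverse (Φ.base x), ⟨Φ.inverse, Φ.base x, h2, h1, hyb, rfl⟩, rfl, hl, key Φ hxb, ?_⟩
  have h := key Φ.inverse hyb
  rwa [show Φ.inverse.base (Φ.base x) = x from hl] at h

/-! ### Sections and prolongations defined by a local isomorphism -/

/-- If `A` and `B` are mutually inverse smooth matrix fields, `(x, y) ↦ A y * B x` is a section. -/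
theorem isSection_of_inverse {U : Set (Model n)} {A B : Model n → Mat n}
    (hA : ContDiffOn ℝ ∞ A U) (hB : ContDiffOn ℝ ∞ B U)
    (hAB : ∀ x ∈ U, A x * B x = 1) (hBA : ∀ x ∈ U, B x * A x = 1) :
    IsSection U fun x y => A y * B x where
  contDiffOn := (hA.comp contDiff_snd.contDiffOn fun _ h => h.2).mul
    (hB.comp contDiff_fst.contDiffOn fun _ h => h.1)
  isUnit x hx y hy :=
    IsUnit.mul ⟨⟨A y, B y, hAB y hy, hBA y hy⟩, rfl⟩ ⟨⟨B x, A x, hBA x hx, hAB x hx⟩, rfl⟩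
  map_comp x hx y hy z hz := by
    rw [mul_assoc, ← mul_assoc (B y), hBA y hy, one_mul]

section Chart

variable {ψ : OpenPartialHomeomorph (Model n) (Model n)}

theorem hasFDerivAt_of_contDiffOn {E F : Type*} [NormedAddCommGroup E] [NormedSpace ℝ E]
    [NormedAddCommGroup F] [NormedSpace ℝ F] {f : E → F} {s : Set E} (hs : IsOpen s)
    (hf : ContDiffOn ℝ ∞ f s) {x : E} (hx : x ∈ s) : HasFDerivAt f (fderiv ℝ f x) x :=
  ((hf.contDiffAt (hs.mem_nhds hx)).differentiableAt (by simp)).hasFDerivAt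

theorem fderiv_symm_mul_fderiv (hψ : ContDiffOn ℝ ∞ ψ ψ.source)
    (hψ' : ContDiffOn ℝ ∞ ψ.symm ψ.target) {x : Model n} (hx : x ∈ ψ.source) :
    fderiv ℝ ψ.symm (ψ x) * fderiv ℝ ψ x = 1 := by
  have h := (hasFDerivAt_of_contDiffOn ψ.open_target hψ' (ψ.map_source hx)).comp x
    (hasFDerivAt_of_contDiffOn ψ.open_source hψ hx)
  have e : (ψ.symm ∘ ψ) =ᶠ[𝓝 x] id := by
    filter_upwards [ψ.open_source.mem_nhds hx] with r hr using ψ.left_inv hr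
  exact (h.fderiv.symm.trans e.fderiv_eq).trans fderiv_id

theorem fderiv_mul_fderiv_symm (hψ : ContDiffOn ℝ ∞ ψ ψ.source)
    (hψ' : ContDiffOn ℝ ∞ ψ.symm ψ.target) {x : Model n} (hx : x ∈ ψ.source) :
    fderiv ℝ ψ x * fderiv ℝ ψ.symm (ψ x) = 1 := by
  have h := fderiv_symm_mul_fderiv (ψ := ψ.symm) hψ' hψ (ψ.map_source hx)
  rwa [ψ.left_inv hx] at h

theorem hasFDerivAt_conj_translation (hψ : ContDiffOn ℝ ∞ ψ ψ.source)
    (hψ' : ContDiffOn ℝ ∞ ψ.symm ψ.target) {x y : Model n} (hx : x ∈ ψ.source)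
    (hy : y ∈ ψ.source) :
    HasFDerivAt (fun r => ψ.symm (ψ r + (ψ y - ψ x)))
      (fderiv ℝ ψ.symm (ψ y) * fderiv ℝ ψ x) x := by
  have h1 := (hasFDerivAt_of_contDiffOn ψ.open_source hψ hx).add_const (ψ y - ψ x)
  have h2 := hasFDerivAt_of_contDiffOn ψ.open_target hψ' (ψ.map_source hy)
  refine HasFDerivAt.comp x (g := ψ.symm) (f := fun r => ψ r + (ψ y - ψ x)) ?_ h1
  simpa using h2

theorem isIntegrableSection_of_chart (hψ : ContDiffOn ℝ ∞ ψ ψ.source)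
    (hψ' : ContDiffOn ℝ ∞ ψ.symm ψ.target) :
    IsIntegrableSection ψ.source fun x y => fderiv ℝ ψ.symm (ψ y) * fderiv ℝ ψ x := by
  refine ⟨isSection_of_inverse (A := fun y => fderiv ℝ ψ.symm (ψ y)) (B := fderiv ℝ ψ) ?_ ?_
    (fun x hx => fderiv_symm_mul_fderiv hψ hψ' hx) fun x hx => fderiv_mul_fderiv_symm hψ hψ' hx,
    fun z hz => ⟨ψ, hz, subset_rfl, hψ, hψ', fun x hx y hy =>
      (hasFDerivAt_conj_translation hψ hψ' hx hy).fderiv.symm⟩⟩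
  · exact (hψ'.fderiv_of_isOpen ψ.open_target (by simp)).comp hψ ψ.mapsTo
  · exact hψ.fderiv_of_isOpen ψ.open_source (by simp)

end Chart

namespace LocalFrameIso

/-- The section `(x, y) ↦ (k y)⁻¹ * k x` defined by the matrix field `k` of a local isomorphism. -/
noncomputable def fiberSection (K : LocalFrameIso n) (x y : Model n) : Mat n :=
  K.inverse.fiber (K.base y) * K.fiber x

/-- The section `(x, y) ↦ (Dκ y)⁻¹ * Dκ x` defined by the base map `κ` of a local isomorphism. -/
noncomputable def baseSection (K : LocalFrameIso n) (x y : Model n) : Mat n :=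
  fderiv ℝ K.base.symm (K.base y) * fderiv ℝ K.base x

theorem isSection_fiberSection (K : LocalFrameIso n) :
    IsSection K.base.source K.fiberSection :=
  isSection_of_inverse (A := fun y => K.inverse.fiber (K.base y)) (B := K.fiber)
    (K.inverse.contDiffOn_fiber.comp K.contDiffOn_base K.base.mapsTo) K.contDiffOn_fiber
    (fun _ hx => K.inverse_fiber_mul_fiber hx) fun _ hx => K.fiber_mul_inverse_fiber hx

theorem isIntegrableSection_baseSection (K : LocalFrameIso n) :
    IsIntegrableSection K.base.source K.baseSection :=
  isIntegrableSection_of_chart K.contDiffOn_base K.contDiffOn_base_symm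

/-- Conjugating translations by `K` gives the prolongation of the two sections defined by `K`. -/
theorem jet_conj_translation (K : LocalFrameIso n) {x y : Model n} (hx : x ∈ K.base.source)
    (hy : y ∈ K.base.source) :
    jet ((K.andThen (translation ((K (y, 1)).1 - (K (x, 1)).1))).andThen K.inverse) x =
      prolongation K.fiberSection K.baseSection x y := by
  set v := K.base y - K.base x with hv
  have hd := hasFDerivAt_conj_translation K.contDiffOn_base K.contDiffOn_base_symm hx hy
  have hP : DifferentiableAt ℝ (fun p : Model n × Model n => K.fiberSection p.1 p.2) (x, y) :=
    (K.isSection_fiberSection.contDiffOn.contDiffAt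
      ((K.base.open_source.prod K.base.open_source).mem_nhds ⟨hx, hy⟩)).differentiableAt (by simp)
  rw [prolongation_eq_jet hP hd (by simp [K.base.left_inv hy])]
  refine jet_congr ?_
  have hc : ContinuousAt (fun r => K.base r + v) x :=
    (K.base.continuousAt hx).add continuousAt_const
  have ht : ∀ᶠ r in 𝓝 x, K.base r + v ∈ K.base.target :=
    hc.eventually (K.base.open_target.mem_nhds (by simpa [hv] using K.base.map_source hy))
  filter_upwards [K.base.open_source.mem_nhds hx, ht] with r hr hrt
  -- the factor `1` is the differential of the translation
  have e : ((K.base r + v, 1 * K.fiber r) : FrameSpace n) ∈ K.inverse.source :=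
    K.inverse.mem_source_iff.2 ⟨hrt, by simpa using K.isUnit_fiber hr⟩
  calc K.inverse (K.base r + v, 1 * K.fiber r)
      = (K.base.symm (K.base r + v), K.inverse.fiber (K.base r + v) * (1 * K.fiber r)) :=
        K.inverse.apply_eq_base_fiber e
    _ = _ := by
        simp only [prolongationMap, fiberSection, one_mul, mul_one]
        rw [← hv, K.base.right_inv hrt]

end LocalFrameIso

/-! ### Homogeneity and integrable prolongations -/

namespace Medium

variable {V : Type*} [NormedAddCommGroup V] [NormedSpace ℝ V] {𝓑 : Medium V}

theorem IsHomogeneousOn.exists_prolongation {U : Set (Model 3)} (h : 𝓑.IsHomogeneousOn U) :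
    ∃ P Q : Model 3 → Model 3 → Mat 3, IsSection U P ∧ IsIntegrableSection U Q ∧
      ∀ x ∈ U, ∀ y ∈ U, prolongation P Q x y ∈ 𝓑.materialGroupoid := by
  obtain ⟨K, hK, hmem⟩ := h
  obtain rfl : K.base.source = U := by
    ext r
    change ((r, 1) : FrameSpace 3) ∈ K.source ↔ _
    rw [hK]
    exact and_iff_left isUnit_one
  refine ⟨K.fiberSection, K.baseSection, K.isSection_fiberSection,
    K.isIntegrableSection_baseSection, fun x hx y hy => ?_⟩
  rw [← K.jet_conj_translation hx hy]
  exact hmem x hx y hy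

/-- The domain of a chart `ψ` for `Q` is homogeneous: the deformation is
`K (r, X) = (ψ r, P r z * X)`, with any base point `z`. -/
theorem isHomogeneousOn_of_prolongation {U : Set (Model 3)}
    {P Q : Model 3 → Model 3 → Mat 3} (hP : IsSection U P)
    (hmem : ∀ x ∈ U, ∀ y ∈ U, prolongation P Q x y ∈ 𝓑.materialGroupoid)
    {ψ : OpenPartialHomeomorph (Model 3) (Model 3)} (hsub : ψ.source ⊆ U)
    (hψ : ContDiffOn ℝ ∞ ψ ψ.source) (hψ' : ContDiffOn ℝ ∞ ψ.symm ψ.target)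
    (hQ : ∀ x ∈ ψ.source, ∀ y ∈ ψ.source,
      Q x y = fderiv ℝ (fun r => ψ.symm (ψ r + (ψ y - ψ x))) x)
    {z : Model 3} (hz : z ∈ U) : 𝓑.IsHomogeneousOn ψ.source := by
  have hM : ContDiffOn ℝ ∞ (fun r => P r z) ψ.source :=
    hP.contDiffOn.comp (contDiff_id.prodMk contDiff_const).contDiffOn fun r hr => ⟨hsub hr, hz⟩
  let K := LocalFrameIso.ofBase ψ (fun r => P r z) hψ hψ' hM
    fun r hr => hP.isUnit r (hsub hr) z hz
  have hs : K.base.source = ψ.source := by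
    ext r
    exact and_iff_left isUnit_one
  refine ⟨K, rfl, fun x hx y hy => ?_⟩
  rw [K.jet_conj_translation (hs ▸ hx) (hs ▸ hy)]
  have hPK : ∀ᶠ p in 𝓝 (x, y), K.fiberSection p.1 p.2 = P p.1 p.2 := by
    filter_upwards [(ψ.open_source.prod ψ.open_source).mem_nhds ⟨hx, hy⟩] with p hp
    have h1 := hsub hp.1
    have h2 := hsub hp.2
    -- the factors `1` are the frames at which `ofBase` evaluates its matrix field
    have e : K.fiberSection p.1 p.2 =
        (Ring.inverse (P (ψ.symm (ψ p.2)) z) * 1) * (P p.1 z * 1) := rfl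
    rw [e, ψ.left_inv hp.2, mul_one, mul_one, ← hP.map_comp p.1 h1 p.2 h2 z hz, ← mul_assoc,
      Ring.inverse_mul_cancel _ (hP.isUnit p.2 h2 z hz), one_mul]
  have hQK : K.baseSection x y = Q x y := by
    rw [hQ x hx y hy, (hasFDerivAt_conj_translation hψ hψ' hx hy).fderiv]
    rfl
  rw [prolongation_congr hPK hQK]
  exact hmem x (hsub hx) y (hsub hy)

theorem isCovered_iff_isLocallyHomogeneous :
    IsCoveredByIntegrableProlongations 𝓑.body 𝓑.materialGroupoid ↔ 𝓑.IsLocallyHomogeneous := by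
  refine ⟨fun h z hz => ?_, fun h z hz => ?_⟩
  · obtain ⟨U, -, hzU, hUB, P, Q, hP, ⟨-, hQ⟩, hmem⟩ := h z hz
    obtain ⟨ψ, hzψ, hsub, hψ, hψ', hQψ⟩ := hQ z hzU
    exact ⟨ψ.source, ψ.open_source, hzψ, hsub.trans hUB,
      isHomogeneousOn_of_prolongation hP hmem hsub hψ hψ' hQψ hzU⟩
  · obtain ⟨U, hU, hzU, hUB, hom⟩ := h z hz
    exact ⟨U, hU, hzU, hUB, hom.exists_prolongation⟩

/-! ### The material groupoid -/

theorem one_mem_materialGroupoid {x : Model 3} (hx : x ∈ 𝓑.body) :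
    NHJet.one x ∈ 𝓑.materialGroupoid := by
  refine ⟨one_mem_nhGroupoid 𝓑.isOpen_body hx, fun g _ h => ?_⟩
  rw [show x = g.src from h.symm, NHJet.comp_one]

theorem comp_mem_materialGroupoid {k j : NHJet 3} (hk : k ∈ 𝓑.materialGroupoid)
    (hj : j ∈ 𝓑.materialGroupoid) (h : k.src = j.tgt) : k.comp j ∈ 𝓑.materialGroupoid := by
  refine ⟨comp_mem_nhGroupoid 𝓑.isOpen_body hk.1 hj.1, fun g hg hs => ?_⟩
  rw [← NHJet.comp_assoc, hj.2 _ (comp_mem_nhGroupoid 𝓑.isOpen_body hg hk.1) h, hk.2 g hg hs]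

theorem exists_inverse_mem_materialGroupoid {j : NHJet 3} (hj : j ∈ 𝓑.materialGroupoid) :
    ∃ k ∈ 𝓑.materialGroupoid, k.src = j.tgt ∧ k.tgt = j.src ∧
      k.comp j = NHJet.one j.src ∧ j.comp k = NHJet.one j.tgt := by
  obtain ⟨k, hk, h1, h2, h3, h4⟩ := exists_inverse_mem_nhGroupoid hj.1
  refine ⟨k, ⟨hk, fun g hg hs => ?_⟩, h1, h2, h3, h4⟩
  rw [← hj.2 _ (comp_mem_nhGroupoid 𝓑.isOpen_body hg hk) h1, NHJet.comp_assoc, h3, ← h2, ← hs,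
    NHJet.comp_one]

theorem isReducedSubgroupoid_materialGroupoid
    (h : ∀ x ∈ 𝓑.body, ∀ y ∈ 𝓑.body, ∃ j ∈ 𝓑.materialGroupoid, j.src = x ∧ j.tgt = y) :
    IsReducedSubgroupoid 𝓑.body 𝓑.materialGroupoid where
  subset _ hj := hj.1
  one_mem _ hx := one_mem_materialGroupoid hx
  comp_mem _ hk _ hj h := comp_mem_materialGroupoid hk hj h
  inv_mem _ hj := exists_inverse_mem_materialGroupoid hj
  transitive := h

theorem IsHomogeneousOn.exists_mem_materialGroupoid {U : Set (Model 3)}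
    (h : 𝓑.IsHomogeneousOn U) {x y : Model 3} (hx : x ∈ U) (hy : y ∈ U) :
    ∃ j ∈ 𝓑.materialGroupoid, j.src = x ∧ j.tgt = y := by
  obtain ⟨P, Q, -, -, hmem⟩ := h.exists_prolongation
  exact ⟨_, hmem x hx y hy, prolongation_src P Q x y, prolongation_tgt P Q x y⟩

theorem IsUniform.exists_mem_materialGroupoid (h : 𝓑.IsUniform) {x y : Model 3}
    (hx : x ∈ 𝓑.body) (hy : y ∈ 𝓑.body) :
    ∃ j ∈ 𝓑.materialGroupoid, j.src = x ∧ j.tgt = y := by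
  obtain ⟨Ψ, h1, h2, hxs, rfl, hW⟩ := h x hx y hy
  exact ⟨jet Ψ x, ⟨⟨Ψ, x, h1, h2, hxs, rfl⟩, hW⟩, rfl, rfl⟩

theorem IsLocallyHomogeneous.exists_mem_materialGroupoid (h : 𝓑.IsLocallyHomogeneous)
    (hB : IsPreconnected 𝓑.body) {x y : Model 3} (hx : x ∈ 𝓑.body) (hy : y ∈ 𝓑.body) :
    ∃ j ∈ 𝓑.materialGroupoid, j.src = x ∧ j.tgt = y := by
  refine hB.induction₂ (fun x y => ∃ j ∈ 𝓑.materialGroupoid, j.src = x ∧ j.tgt = y)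
    (fun x hx => ?_) (fun x y z _ _ _ hxy hyz => ?_) (fun x y _ _ hxy => ?_) hx hy
  · obtain ⟨U, hU, hxU, -, hom⟩ := h x hx
    filter_upwards [mem_nhdsWithin_of_mem_nhds (hU.mem_nhds hxU)] with y hyU
    exact hom.exists_mem_materialGroupoid hxU hyU
  · obtain ⟨j, hj, rfl, rfl⟩ := hxy
    obtain ⟨k, hk, hkj, rfl⟩ := hyz
    exact ⟨k.comp j, comp_mem_materialGroupoid hk hj hkj, rfl, rfl⟩
  · obtain ⟨j, hj, rfl, rfl⟩ := hxy
    obtain ⟨k, hk, h1, h2, -⟩ := exists_inverse_mem_materialGroupoid hj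
    exact ⟨k, hk, h1, h2⟩

end Medium

end Cosserat

theorem mainTheorem1 {V : Type*} [NormedAddCommGroup V] [NormedSpace ℝ V]
    (𝓑 : Cosserat.Medium V) :
    (𝓑.IsHomogeneous →
      Cosserat.IsIntegrableProlongation 𝓑.body 𝓑.materialGroupoid) ∧
    (Cosserat.IsCoveredByIntegrableProlongations 𝓑.body 𝓑.materialGroupoid ↔
      𝓑.IsLocallyHomogeneous) ∧
    (𝓑.IsUniform ∨ IsPreconnected 𝓑.body →
      (Cosserat.IsIntegrableProlongation 𝓑.body 𝓑.materialGroupoid ↔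
        𝓑.IsLocallyHomogeneous)) := by
  have iff := Cosserat.Medium.isCovered_iff_isLocallyHomogeneous (𝓑 := 𝓑)
  refine ⟨fun h => ⟨?_, ?_⟩, iff, fun h => ⟨fun hI => iff.1 hI.2, fun hL => ⟨?_, iff.2 hL⟩⟩⟩
  · exact Cosserat.Medium.isReducedSubgroupoid_materialGroupoid fun x hx y hy =>
      Cosserat.Medium.IsHomogeneousOn.exists_mem_materialGroupoid h hx hy
  · exact iff.2 fun z hz => ⟨𝓑.body, 𝓑.isOpen_body, hz, subset_rfl, h⟩
  · refine Cosserat.Medium.isReducedSubgroupoid_materialGroupoid fun x hx y hy => ?_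
    rcases h with h | h
    · exact h.exists_mem_materialGroupoid hx hy
    · exact hL.exists_mem_materialGroupoid h hx hy
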